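/- **Setting.** There are finitely many t-objects $x_1,\dots,x_n$; transactions are identified with their timestamps $0,1,2,\dots$. A (sequential) *history* is a finite sequence of events, each being one operation of a transaction with its response: the start of $T_k$; a read $r_k(x,v)$ or $r_k(x,A)$; a write $w_k(x,v)$ or $w_k(x,v,A)$; a successful commit $c_k$; a commit attempt that aborts; or $a_k$ (the result of $tryA_k$). $T_k$ is *committed* in $H$ if $c_k$ occurs in $H$, *aborted* if one of its operations returned abort, *complete* if it is committed or aborted, and otherwise (if it occurs in $H$) *live*. A *committed writer of $x$* is a committed transaction $T_k$ with some event $w_k(x,v)$. *Opacity.* $T_k\prec_H^{RT}T_m$ means that $T_k$ is complete in $H$ and its last event precedes the first event of $T_m$. $H$ is *t-sequential* if any two distinct transactions are related by $\prec^{RT}_H$. $H$ is *valid* if each successful read $r_k(x,v)$ is preceded by the commit of some $T_j$ with $w_j(x,v)\in H$; it is *legal* if, for each successful read $r_k(x,v)$, the latest commit before it of a transaction writing to $x$ is that of a transaction that writes $v$ to $x$. The completion $\overline H$ inserts $a_k$ right after the last event of every live $T_k$. $H$ is *opaque* if it is valid and there is a t-sequential legal history $S$ with the same events as $\overline H$ (in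 the same order within each transaction) such that $\prec_H^{RT}\subseteq\prec_S^{RT}$. **The MVTO algorithm with garbage collection.** Operations are executed atomically, one after the other, in the order of the history (the linearized history $H_{gc}$). The state consists of a counter, a set $liveL$ of live transactions, a local write list for each transaction, and for each object $x$ a version list $x.vl$ of tuples $\langle ts,v,rl,nts\rangle$. Initially $T_0$ has written $0$ to every object and committed, every version list is $[\langle 0,0,nil,nil\rangle]$, the counter is $1$ and $liveL=\emptyset$. Let $find(i,x)$ be the tuple of $x.vl$ with the largest timestamp smaller than $i$ (the tuple $\langle 0,0,nil,nil\rangle$, not stored in the list, if there is none). * *Start*: the new transaction gets the counter value $i$ as identifier, $i$ is added to $liveL$, and the counter is increased by $1$. * Every other operation is issued by some $i\in liveL$. *Read* of $x$: return the value of $find(i,x)$ and append $i$ to the read list $rl$ of that tuple. *Write* of $v$ to $x$: append $(x,v)$ to the write list of $T_i$. *$tryA$*: abort, removing $i$ from $liveL$. * *$tryC$*: if for some $x$ in the write list of $T_i$ some tuple of $x.vl$ has timestamp $j$ and a reader $k\in rl$ with $j<i<k$, then abort. Otherwise, for every $x$ in the write list, with $v$ the value last written to $x$ by $T_i$: let $prev=find(i,x)$,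 insert $\langle i,v,nil,prev.nts\rangle$ into $x.vl$ in timestamp order, set $prev.nts:=i$ and, if $|x.vl|$ now exceeds the threshold, garbage-collect $x$; then commit. In both cases $i$ is finally removed from $liveL$. The threshold is arbitrary and may vary between operations and objects. * *Garbage collection of $x$*: delete exactly those tuples of $x.vl$ with $nts\neq nil$ for which no $j\in liveL$ satisfies $ts<j<nts$. For a timestamp $l$ let $\mathrm{lts}(l,x,H)$ be the committed writer of $x$ in $H$ with the largest timestamp smaller than $l$, and $\mathrm{stl}(l,x,H)$ the committed writer of $x$ in $H$ with the smallest timestamp larger than $l$ ($nil$ if there is none). $T_k$ *reads $x$ from* $T_j$ in $H$ if $w_j(x,v)\in H$ and $c_j$ precedes a read $r_k(x,v)$ in $H$, for some $v$. **Statement.** Let $H$ be a history generated by the MVTO algorithm with garbage collection in which different transactions (including $T_0$) never write the same value to the same object. Then: 1. For every prefix $H_p$ of $H$ generated by an execution of the algorithm, with the state after it, and every object $x$: (a) for every live transaction $T_l$ of $H_p$, $T_j=\mathrm{lts}(l,x,H_p)$ exists, $x.vl$ contains the tuple created by $T_j$ (it has not been deleted), and its $nts$ entry equals $\mathrm{stl}(l,x,H_p)$;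 (b) every tuple in $x.vl$ was created by a committed writer of $x$, and its $nts$ entry equals $\mathrm{stl}(ts,x,H_p)$. 2. (Read rule) If $T_k$ reads $x$ from $T_j$ in $H$, then $T_j=\mathrm{lts}(k,x,H)$. 3. (Write rule) If $T_k$ reads $x$ from $T_j$ in $H$ and $T_i$ is a committed writer of $x$ in $H$ with $i\ne j$ and $i\neq k$, then exactly one of $i<j$ and $k<i$ holds. 4. $H$ is opaque. -/

import Mathlib

/-! ## Sequential histories of transactional operations

Transactions are identified with their timestamps (natural numbers), the t-objects are
`x_1, …, x_n`, i.e. the elements of `Fin n`. -/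

/-- An event of a sequential history: an operation of a transaction with its response. -/
inductive Event (n : ℕ) (V : Type*) where
  /-- the operation that starts transaction `k` and returns its identifier -/
  | start (k : ℕ)
  /-- successful read `r_k(x, v)` -/
  | read (k : ℕ) (x : Fin n) (v : V)
  /-- forcefully aborted read `r_k(x, A)` -/
  | readAbort (k : ℕ) (x : Fin n)
  /-- successful write `w_k(x, v)` -/
  | write (k : ℕ) (x : Fin n) (v : V)
  /-- forcefully aborted write `w_k(x, v, A)` -/
  | writeAbort (k : ℕ) (x : Fin n) (v : V)
  /-- successful `tryC_k`, i.e. `c_k` -/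
  | commit (k : ℕ)
  /-- forcefully aborted `tryC_k` -/
  | commitAbort (k : ℕ)
  /-- `tryA_k`, i.e. `a_k` -/
  | tryA (k : ℕ)

namespace Event

/-- The transaction that an event belongs to. -/
def tx {n : ℕ} {V : Type*} : Event n V → ℕ
  | start k => k
  | read k _ _ => k
  | readAbort k _ => k
  | write k _ _ => k
  | writeAbort k _ _ => k
  | commit k => k
  | commitAbort k => k
  | tryA k => k

/-- The event is an operation that returned `A`. -/
def IsAbort {n : ℕ} {V : Type*} : Event n V → Prop
  | start _ => False
  | read _ _ _ => False
  | readAbort _ _ => True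
  | write _ _ _ => False
  | writeAbort _ _ _ => True
  | commit _ => False
  | commitAbort _ => True
  | tryA _ => True

end Event

/-- A sequential history: the list of its events in the order of their occurrence. -/
abbrev History (n : ℕ) (V : Type*) := List (Event n V)

namespace History

variable {n : ℕ} {V : Type*}

/-- `T_k` appears in `H`. -/
def HasTx (H : History n V) (k : ℕ) : Prop := ∃ e ∈ H, e.tx = k

/-- `T_k` is committed in `H`. -/
def Committed (H : History n V) (k : ℕ) : Prop := Event.commit k ∈ H

/-- `T_k` is aborted in `H`. -/
def Aborted (H : History n V) (k : ℕ) : Prop := ∃ e ∈ H, e.tx = k ∧ e.IsAbort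

/-- `T_k` is complete in `H`. -/
def Complete (H : History n V) (k : ℕ) : Prop := H.Committed k ∨ H.Aborted k

/-- `T_k` is incomplete (live) in `H`. -/
def Live (H : History n V) (k : ℕ) : Prop := H.HasTx k ∧ ¬ H.Committed k ∧ ¬ H.Aborted k

/-- `T_k` writes to `x` in `H`. -/
def Writes (H : History n V) (k : ℕ) (x : Fin n) : Prop := ∃ v, Event.write k x v ∈ H

/-- `T_k` is a committed transaction that writes to `x`. -/
def CommittedWriter (H : History n V) (x : Fin n) (k : ℕ) : Prop :=
  H.Committed k ∧ H.Writes k x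

/-- `H|T_k`: the subsequence of the events of `T_k`. -/
def proj (H : History n V) (k : ℕ) : History n V := H.filter (fun e => e.tx = k)

/-- `T_k ≺ T_m` in the real-time order of `H`: `T_k` is complete and its last event precedes
the first event of `T_m`. -/
def RT (H : History n V) (k m : ℕ) : Prop :=
  H.Complete k ∧ H.HasTx m ∧
    ∀ (p q : ℕ) (e f : Event n V), H[p]? = some e → H[q]? = some f →
      e.tx = k → f.tx = m → p < q

/-- No two transactions overlap. -/
def TSequential (H : History n V) : Prop :=
  ∀ k m, H.HasTx k → H.HasTx m → k ≠ m → H.RT k m ∨ H.RT m k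

/-- Every successful read `r_k(x, v)` is preceded by the commit of a transaction that
writes `v` to `x`. -/
def Valid (H : History n V) : Prop :=
  ∀ (p k : ℕ) (x : Fin n) (v : V), H[p]? = some (Event.read k x v) →
    ∃ q j : ℕ, q < p ∧ H[q]? = some (Event.commit j) ∧ Event.write j x v ∈ H

/-- For every successful read `r_k(x, v)`, the latest preceding commit event of a transaction
that writes to `x` belongs to a transaction that writes `v` to `x`. -/
def Legal (H : History n V) : Prop :=
  ∀ (p k : ℕ) (x : Fin n) (v : V), H[p]? = some (Event.read k x v) →
    ∃ q i : ℕ, q < p ∧ H[q]? = some (Event.commit i) ∧ H.Writes i x ∧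
      (∀ q' i' : ℕ, q < q' → q' < p → H[q']? = some (Event.commit i') → ¬ H.Writes i' x) ∧
      Event.write i x v ∈ H

open Classical in
/-- `completeFrom H R` inserts into the suffix `R` of `H` the event `a_k` immediately after the
last event of each transaction `T_k` that is incomplete in `H`. -/
noncomputable def completeFrom (H : History n V) : History n V → History n V
  | [] => []
  | e :: R =>
    if H.Live e.tx ∧ ¬ HasTx R e.tx then e :: Event.tryA e.tx :: completeFrom H R
    else e :: completeFrom H R

/-- The completion of `H`. -/
noncomputable def completion (H : History n V) : History n V := completeFrom H H

/-- The histories consist of the same events; the events of every single transaction come in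
the same order in both. -/
def Equivalent (H H' : History n V) : Prop := ∀ k, H.proj k = H'.proj k

/-- Opacity. -/
def IsOpaque (H : History n V) : Prop :=
  H.Valid ∧ ∃ S : History n V, S.TSequential ∧ S.Legal ∧ Equivalent S H.completion ∧
    ∀ k m, H.RT k m → S.RT k m

/-- Different transactions write different values to the same t-object. -/
def UniqueWrites (H : History n V) : Prop :=
  ∀ (i j : ℕ) (x : Fin n) (v : V), Event.write i x v ∈ H → Event.write j x v ∈ H → i = j

/-- `T_k` reads `x` from `T_j`: there is a successful read `r_k(x, v)` such that `T_j` commits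
before it and `T_j` writes `v` to `x`. -/
def ReadsFrom (H : History n V) (k : ℕ) (x : Fin n) (j : ℕ) : Prop :=
  ∃ (p q : ℕ) (v : V), q < p ∧ H[p]? = some (Event.read k x v) ∧
    H[q]? = some (Event.commit j) ∧ Event.write j x v ∈ H

/-- `T_j` is the committed transaction with the largest timestamp smaller than `l` that
writes to `x`. -/
def IsLTS (H : History n V) (l : ℕ) (x : Fin n) (j : ℕ) : Prop :=
  H.CommittedWriter x j ∧ j < l ∧ ∀ i, H.CommittedWriter x i → i < l → i ≤ j

/-- `some k`: `T_k` is the committed transaction with the smallest timestamp larger than `l`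
that writes to `x`; `none` (nil): there is no such transaction. -/
def IsSTL (H : History n V) (l : ℕ) (x : Fin n) : Option ℕ → Prop
  | some k => H.CommittedWriter x k ∧ l < k ∧ ∀ i, H.CommittedWriter x i → l < i → k ≤ i
  | none => ∀ i, H.CommittedWriter x i → ¬ l < i

end History

/-! ## The multiversion timestamp ordering algorithm with garbage collection -/

/-- A version tuple `⟨ts, v, rl, nts⟩`. -/
structure VTuple (V : Type*) where
  /-- timestamp of the transaction that created the version -/
  ts : ℕ
  /-- value of the version -/
  val : V
  /-- read list: the transactions that have read the version -/
  rl : List ℕ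
  /-- next timestamp, `none` for nil -/
  nts : Option ℕ

/-- The data structures of the algorithm. -/
structure MVState (n : ℕ) (V : Type*) where
  /-- the counter that generates timestamps -/
  tcntr : ℕ
  /-- the list of live transactions -/
  liveL : Finset ℕ
  /-- the local write list of each transaction, in the order of its writes -/
  ws : ℕ → List (Fin n × V)
  /-- the version list of each t-object -/
  vl : Fin n → List (VTuple V)

namespace MVTO

variable {n : ℕ} {V : Type*}

/-- The tuple of the version list `L` with the largest timestamp smaller than `i`; the search
starts from the tuple `⟨0, 0, nil, nil⟩`. -/
def findLts [Zero V] (i : ℕ) (L : List (VTuple V)) : VTuple V :=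
  L.foldl (fun closest t => if t.ts < i ∧ closest.ts ≤ t.ts then t else closest)
    ⟨0, 0, [], none⟩

/-- Apply `f` to the tuple with timestamp `j`, if it is in the list. -/
def modifyAt (j : ℕ) (f : VTuple V → VTuple V) (L : List (VTuple V)) : List (VTuple V) :=
  L.map (fun t => if t.ts = j then f t else t)

/-- The version list after `read_i(x)`: `i` is appended to the read list of the tuple found. -/
def readUpdate [Zero V] (i : ℕ) (L : List (VTuple V)) : List (VTuple V) :=
  modifyAt (findLts i L).ts (fun t => { t with rl := t.rl ++ [i] }) L

/-- No tuple `⟨j, v, rl, nts⟩` of the list has a reader `k` in `rl` with `j < i < k`. -/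
def CheckVersion (i : ℕ) (L : List (VTuple V)) : Prop :=
  ∀ t ∈ L, ∀ k ∈ t.rl, ¬ (t.ts < i ∧ i < k)

/-- Garbage collection: a tuple is deleted iff its `nts` is not nil and no live transaction has
its timestamp strictly between `ts` and `nts`. -/
def gc (live : Finset ℕ) (L : List (VTuple V)) : List (VTuple V) :=
  L.filter (fun t =>
    match t.nts with
    | none => true
    | some m => decide (∃ j ∈ live, t.ts < j ∧ j < m))

/-- Insertion of the version `(i, v)` into a version list, followed by garbage collection if
the number of versions exceeds the threshold. -/
def insTuple [Zero V] (threshold : ℕ) (live : Finset ℕ) (i : ℕ) (v : V)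
    (L : List (VTuple V)) : List (VTuple V) :=
  let prev := findLts i L
  let cur : VTuple V := ⟨i, v, [], prev.nts⟩
  let L' := (modifyAt prev.ts (fun t => { t with nts := some i }) L).orderedInsert
    (fun a b => a.ts ≤ b.ts) cur
  if threshold < L'.length then gc live L' else L'

/-- The value last written to `x` in a write list, if there is one. -/
def writeVal (ws : List (Fin n × V)) (x : Fin n) : Option V :=
  (ws.reverse.find? (fun d => d.1 = x)).map Prod.snd

/-- The version lists after a transaction with write list `ws` has inserted its versions. -/
def install [Zero V] (threshold : Fin n → ℕ) (live : Finset ℕ) (i : ℕ)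
    (ws : List (Fin n × V)) (vl : Fin n → List (VTuple V)) : Fin n → List (VTuple V) :=
  fun x =>
    match writeVal ws x with
    | none => vl x
    | some v => insTuple (threshold x) live i v (vl x)

/-- One operation of the algorithm, executed atomically, with the event that it generates.
Every operation other than the start of a transaction is issued by a live transaction. The
threshold for garbage collection is not fixed: it may differ between operations and objects. -/
inductive Step [Zero V] : MVState n V → Event n V → MVState n V → Prop
  | start (s : MVState n V) :
      Step s (Event.start s.tcntr)
        { s with tcntr := s.tcntr + 1, liveL := insert s.tcntr s.liveL }
  | read (s : MVState n V) (i : ℕ) (x : Fin n) (hi : i ∈ s.liveL) :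
      Step s (Event.read i x (findLts i (s.vl x)).val)
        { s with vl := Function.update s.vl x (readUpdate i (s.vl x)) }
  | write (s : MVState n V) (i : ℕ) (x : Fin n) (v : V) (hi : i ∈ s.liveL) :
      Step s (Event.write i x v)
        { s with ws := Function.update s.ws i (s.ws i ++ [(x, v)]) }
  | commitReadOnly (s : MVState n V) (i : ℕ) (hi : i ∈ s.liveL) (hw : s.ws i = []) :
      Step s (Event.commit i) { s with liveL := s.liveL.erase i }
  | commitUpdate (s : MVState n V) (i : ℕ) (threshold : Fin n → ℕ) (hi : i ∈ s.liveL)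
      (hw : s.ws i ≠ []) (hc : ∀ d ∈ s.ws i, CheckVersion i (s.vl d.1)) :
      Step s (Event.commit i)
        { s with
          vl := install threshold s.liveL i (s.ws i) s.vl
          liveL := s.liveL.erase i }
  | commitAbort (s : MVState n V) (i : ℕ) (hi : i ∈ s.liveL)
      (hc : ¬ ∀ d ∈ s.ws i, CheckVersion i (s.vl d.1)) :
      Step s (Event.commitAbort i) { s with liveL := s.liveL.erase i }
  | tryA (s : MVState n V) (i : ℕ) (hi : i ∈ s.liveL) :
      Step s (Event.tryA i) { s with liveL := s.liveL.erase i }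

/-- The state after initialization. -/
def initState [Zero V] : MVState n V where
  tcntr := 1
  liveL := ∅
  ws := fun _ => []
  vl := fun _ => [⟨0, 0, [], none⟩]

/-- The events of the initial committed transaction `T_0`, which writes `0` to all objects. -/
def initHistory [Zero V] : History n V :=
  Event.start 0 :: ((List.finRange n).map (fun x => Event.write 0 x 0) ++ [Event.commit 0])

/-- `Run H s`: some execution of the algorithm generates the history `H` and ends in state `s`. -/
inductive Run [Zero V] : History n V → MVState n V → Prop
  | init : Run initHistory initState
  | step {H : History n V} {s s' : MVState n V} {e : Event n V} :
      Run H s → Step s e s' → Run (H ++ [e]) s'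

/-- The tuple in `x.vl` created by `T_j`, nil (`none`) if there is no such tuple. -/
def version (s : MVState n V) (x : Fin n) (j : ℕ) : Option (VTuple V) :=
  (s.vl x).find? (fun t => t.ts = j)

end MVTO

/-! ## Abstract successor and predecessor among a set of timestamps -/

/-! Fix an object `x` and let `C` be its set of committed writers. Every execution keeps three facts
about `x.vl` (`ListInv`): each tuple belongs to an element of `C`, its `nts` is the successor of its
timestamp in `C`, and for every active `l` (live or not yet started) the predecessor of `l` in `C`
has a tuple. Garbage collection is harmless: if `j` is the predecessor of a live `l` and `m` its
successor, then `j < l < m`, since `l` is not committed, so the tuple of `j` is kept; the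
predecessor of an unstarted `l` is the maximum of `C`, and its `nts` is nil (`ListInv.insTuple`).
Hence every read returns the version of the predecessor of the reader. It remains the predecessor:
if `i` commits a write with `j < i < k`, where `k` has read from `j`, then `j` is the predecessor of
`i` too, so its tuple is still in the list with `k` in its read list, and the check of `i` fails
(`Inv.step_commitUpdate`). The read and write rules follow from this. For opacity, the completed
transactions are serialized by timestamp: predecessors make this order legal, and it extends the
real-time order because timestamps increase with the starts. -/

/-- `j` is the largest element of `C` below `l`. -/
def IsPredIn (C : ℕ → Prop) (l j : ℕ) : Prop :=
  C j ∧ j < l ∧ ∀ i, C i → i < l → i ≤ j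

/-- The option `o` is the smallest element of `C` above `l`, `none` if there is none. -/
def IsSuccIn (C : ℕ → Prop) (l : ℕ) (o : Option ℕ) : Prop :=
  (∀ k, o = some k → C k ∧ l < k ∧ ∀ i, C i → l < i → k ≤ i) ∧
    (o = none → ∀ i, C i → ¬ l < i)

theorem isSTL_iff {n : ℕ} {V : Type*} (H : History n V) (l : ℕ) (x : Fin n) (o : Option ℕ) :
    H.IsSTL l x o ↔ IsSuccIn (H.CommittedWriter x) l o := by
  cases o <;> simp [History.IsSTL, IsSuccIn]

/-- The predecessor of `l` and `l` itself have the same successor if `l` is not in the set. -/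
theorem IsSuccIn.of_pred {C : ℕ → Prop} {l j : ℕ} {o : Option ℕ} (h : IsSuccIn C j o)
    (hj : IsPredIn C l j) (hl : ¬ C l) : IsSuccIn C l o := by
  refine ⟨fun k hk => ?_, fun ho i hi hli => h.2 ho i hi (hj.2.1.trans hli)⟩
  obtain ⟨h1, h2, h3⟩ := h.1 k hk
  refine ⟨h1, ?_, fun i hi hli => h3 i hi (hj.2.1.trans hli)⟩
  by_contra hkl
  rcases (not_lt.1 hkl).lt_or_eq with hlt | rfl
  · exact absurd (hj.2.2 k h1 hlt) (not_le.2 h2)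
  · exact hl h1

/-- The successor of the predecessor of `l`, if there is one, is not below `l`. -/
theorem IsSuccIn.le_of_pred {C : ℕ → Prop} {l j m : ℕ} (h : IsSuccIn C j (some m))
    (hj : IsPredIn C l j) : l ≤ m := by
  obtain ⟨h1, h2, -⟩ := h.1 m rfl
  by_contra hlt
  exact absurd (hj.2.2 m h1 (not_le.1 hlt)) (not_le.2 h2)

/-! ## Version lists -/

namespace MVTO

variable {n : ℕ} {V : Type*}

theorem findLts_foldl_spec (i : ℕ) (L : List (VTuple V)) (c : VTuple V) :
    (L.foldl (fun closest t => if t.ts < i ∧ closest.ts ≤ t.ts then t else closest) c = c ∧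
        (∀ t ∈ L, t.ts < i → t.ts < c.ts)) ∨
      ∃ t ∈ L, L.foldl (fun closest t =>
        if t.ts < i ∧ closest.ts ≤ t.ts then t else closest) c = t ∧ t.ts < i ∧ c.ts ≤ t.ts ∧
          ∀ t' ∈ L, t'.ts < i → t'.ts ≤ t.ts := by
  induction L generalizing c with
  | nil => simp
  | cons a L ih =>
    rw [List.foldl_cons]
    split_ifs with h
    · right
      rcases ih a with ⟨h1, h2⟩ | ⟨t, ht, h1, h2, h3, h4⟩
      · refine ⟨a, by simp, h1, h.1, h.2, fun t' ht' hlt => ?_⟩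
        rcases List.mem_cons.1 ht' with rfl | ht'
        · exact le_rfl
        · exact (h2 t' ht' hlt).le
      · refine ⟨t, by simp [ht], h1, h2, h.2.trans h3, fun t' ht' hlt => ?_⟩
        rcases List.mem_cons.1 ht' with rfl | ht'
        · exact h3
        · exact h4 t' ht' hlt
    · rcases ih c with ⟨h1, h2⟩ | ⟨t, ht, h1, h2, h3, h4⟩
      · left
        refine ⟨h1, fun t' ht' hlt => ?_⟩
        rcases List.mem_cons.1 ht' with rfl | ht'
        · exact not_le.1 fun hle => h ⟨hlt, hle⟩
        · exact h2 t' ht' hlt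
      · right
        refine ⟨t, by simp [ht], h1, h2, h3, fun t' ht' hlt => ?_⟩
        rcases List.mem_cons.1 ht' with rfl | ht'
        · exact (not_le.1 fun hle => h ⟨hlt, hle⟩).le.trans h3
        · exact h4 t' ht' hlt

/-- If the list has a tuple with timestamp below `i`, then `findLts` returns such a tuple, with
the largest timestamp. -/
theorem findLts_spec [Zero V] {i : ℕ} {L : List (VTuple V)} (h : ∃ t ∈ L, t.ts < i) :
    findLts i L ∈ L ∧ (findLts i L).ts < i ∧ ∀ t ∈ L, t.ts < i → t.ts ≤ (findLts i L).ts := by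
  obtain ⟨t, ht, hti⟩ := h
  -- The default tuple has timestamp 0, so if it survived the fold, an eligible tuple would have a
  -- negative timestamp.
  rcases findLts_foldl_spec i L ⟨0, 0, [], none⟩ with ⟨-, h2⟩ | ⟨t', ht', h1, h2, -, h4⟩
  · exact absurd (h2 t ht hti) (Nat.not_lt_zero _)
  · unfold findLts
    rw [h1]
    exact ⟨ht', h2, h4⟩

/-! ### Version-list invariant and reads -/

/-- The invariant of a version list: every tuple belongs to a committed writer (an element of
`C`) and has the right `nts` entry, and the tuple that an active transaction would read is
present. -/
structure ListInv (C A : ℕ → Prop) (L : List (VTuple V)) : Prop where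
  writer : ∀ t ∈ L, C t.ts
  succ : ∀ t ∈ L, IsSuccIn C t.ts t.nts
  active : ∀ l, A l → ∃ t ∈ L, IsPredIn C l t.ts

theorem ListInv.congr {C C' A A' : ℕ → Prop} {L : List (VTuple V)} (h : ListInv C A L)
    (hC : ∀ k, C' k ↔ C k) (hA : ∀ k, A' k → A k) : ListInv C' A' L := by
  obtain rfl : C' = C := funext fun k => propext (hC k)
  exact ⟨h.writer, h.succ, fun l hl => h.active l (hA l hl)⟩

theorem ListInv.findLts_mem [Zero V] {C A : ℕ → Prop} {L : List (VTuple V)}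
    (h : ListInv C A L) {i : ℕ} (hi : A i) :
    findLts i L ∈ L ∧ IsPredIn C i (findLts i L).ts := by
  obtain ⟨t, ht, hp⟩ := h.active i hi
  obtain ⟨h1, h2, h3⟩ := findLts_spec ⟨t, ht, hp.2.1⟩
  exact ⟨h1, h.writer _ h1, h2, fun j hj hji => (hp.2.2 j hj hji).trans (h3 t ht hp.2.1)⟩

theorem mem_modifyAt {j : ℕ} {f : VTuple V → VTuple V} {L : List (VTuple V)} {t : VTuple V} :
    t ∈ modifyAt j f L ↔ ∃ u ∈ L, (if u.ts = j then f u else u) = t := by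
  simp [modifyAt]

/-- A tuple of the updated list differs from a tuple of the old one only in its read list. -/
theorem mem_readUpdate [Zero V] {i : ℕ} {L : List (VTuple V)} {t : VTuple V}
    (h : t ∈ readUpdate i L) :
    ∃ u ∈ L, t.ts = u.ts ∧ t.val = u.val ∧ t.nts = u.nts ∧ (∀ k ∈ u.rl, k ∈ t.rl) ∧
      (t.ts = (findLts i L).ts → i ∈ t.rl) := by
  obtain ⟨u, hu, rfl⟩ := mem_modifyAt.1 h
  refine ⟨u, hu, ?_⟩
  split_ifs with h
  · simp +contextual
  · simp [h]

theorem exists_mem_readUpdate [Zero V] {i : ℕ} {L : List (VTuple V)} {u : VTuple V}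
    (h : u ∈ L) : ∃ t ∈ readUpdate i L, t.ts = u.ts := by
  refine ⟨_, mem_modifyAt.2 ⟨u, h, rfl⟩, ?_⟩
  split_ifs <;> rfl

theorem ListInv.readUpdate [Zero V] {C A : ℕ → Prop} {L : List (VTuple V)}
    (h : ListInv C A L) (i : ℕ) : ListInv C A (readUpdate i L) where
  writer t ht := by
    obtain ⟨u, hu, h1, -⟩ := mem_readUpdate ht
    exact h1 ▸ h.writer u hu
  succ t ht := by
    obtain ⟨u, hu, h1, -, h2, -⟩ := mem_readUpdate ht
    rw [h1, h2]
    exact h.succ u hu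
  active l hl := by
    obtain ⟨u, hu, hp⟩ := h.active l hl
    obtain ⟨t, ht, h1⟩ := exists_mem_readUpdate (i := i) hu
    exact ⟨t, ht, h1 ▸ hp⟩

/-! ### Insertion of a version and garbage collection -/

/-- The version list with the new version, before garbage collection. -/
def insVersion [Zero V] (i : ℕ) (v : V) (L : List (VTuple V)) : List (VTuple V) :=
  (modifyAt (findLts i L).ts (fun t => { t with nts := some i }) L).orderedInsert
    (fun a b => a.ts ≤ b.ts) ⟨i, v, [], (findLts i L).nts⟩

theorem mem_insVersion [Zero V] {i : ℕ} {v : V} {L : List (VTuple V)} {t : VTuple V} :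
    t ∈ insVersion i v L ↔ t = ⟨i, v, [], (findLts i L).nts⟩ ∨
      ∃ u ∈ L, (if u.ts = (findLts i L).ts then { u with nts := some i } else u) = t := by
  rw [insVersion, List.mem_orderedInsert, mem_modifyAt]

theorem mem_gc {live : Finset ℕ} {L : List (VTuple V)} {t : VTuple V} :
    t ∈ gc live L ↔ t ∈ L ∧ ∀ m, t.nts = some m → ∃ j ∈ live, t.ts < j ∧ j < m := by
  rw [gc, List.mem_filter]
  cases t.nts <;> simp

theorem mem_of_mem_insTuple [Zero V] {th : ℕ} {live : Finset ℕ} {i : ℕ} {v : V}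
    {L : List (VTuple V)} {t : VTuple V} (h : t ∈ insTuple th live i v L) :
    t ∈ insVersion i v L := by
  have : insTuple th live i v L = if th < (insVersion i v L).length then
    gc live (insVersion i v L) else insVersion i v L := rfl
  rw [this] at h
  split_ifs at h
  · exact (mem_gc.1 h).1
  · exact h

/-- The condition `hl` is vacuous when `nts` is nil, so a newest version always survives. -/
theorem mem_insTuple_of_live [Zero V] {th : ℕ} {live : Finset ℕ} {i : ℕ} {v : V}
    {L : List (VTuple V)} {t : VTuple V} (h : t ∈ insVersion i v L)
    (hl : ∀ m, t.nts = some m → ∃ j ∈ live, t.ts < j ∧ j < m) :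
    t ∈ insTuple th live i v L := by
  have : insTuple th live i v L = if th < (insVersion i v L).length then
    gc live (insVersion i v L) else insVersion i v L := rfl
  rw [this]
  split_ifs
  · exact mem_gc.2 ⟨h, hl⟩
  · exact h

theorem mem_insVersion_fields [Zero V] {i : ℕ} {v : V} {L : List (VTuple V)} {t : VTuple V}
    (h : t ∈ insVersion i v L) :
    (t.ts = i ∧ t.val = v) ∨ ∃ u ∈ L, t.ts = u.ts ∧ t.val = u.val ∧ t.rl = u.rl := by
  rcases mem_insVersion.1 h with rfl | ⟨u, hu, rfl⟩
  · exact Or.inl ⟨rfl, rfl⟩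
  · refine Or.inr ⟨u, hu, ?_⟩
    split_ifs <;> simp

/-- Inserting `i` into `C` splits one gap: `i` inherits the successor of its predecessor, the
predecessor now points to `i`, and all other links stay. Distinctness of the timestamps in the list
is not needed, because `modifyAt` treats all tuples with the same timestamp alike. -/
theorem ListInv.insVersion [Zero V] {C A : ℕ → Prop} {L : List (VTuple V)}
    (h : ListInv C A L) {i : ℕ} (v : V) (hi : A i) (hC : ¬ C i) :
    ListInv (fun k => C k ∨ k = i) (fun k => A k ∧ k ≠ i) (insVersion i v L) where
  writer t ht := by
    rcases mem_insVersion_fields ht with ⟨h1, -⟩ | ⟨u, hu, h1, -⟩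
    · exact Or.inr h1
    · exact Or.inl (h1 ▸ h.writer u hu)
  succ t ht := by
    obtain ⟨hf, hp⟩ := h.findLts_mem hi
    rcases mem_insVersion.1 ht with rfl | ⟨u, hu, rfl⟩
    · have hs := (h.succ _ hf).of_pred hp hC
      refine ⟨fun k hk => ?_, fun ho j hj hij => ?_⟩
      · obtain ⟨h1, h2, h3⟩ := hs.1 k hk
        refine ⟨Or.inl h1, h2, fun j hj hij => ?_⟩
        rcases hj with hj | rfl
        · exact h3 j hj hij
        · exact absurd hij (lt_irrefl _)
      · rcases hj with hj | rfl
        · exact hs.2 ho j hj hij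
        · exact lt_irrefl _ hij
    · have hs := h.succ u hu
      have hCu := h.writer u hu
      split_ifs with hts
      · refine ⟨fun k hk => ?_, fun ho => by simp at ho⟩
        obtain rfl : i = k := by simpa using hk
        refine ⟨Or.inr rfl, hts ▸ hp.2.1, fun j hj hij => ?_⟩
        rcases hj with hj | rfl
        · by_contra hlt
          have h1 := hp.2.2 j hj (not_le.1 hlt)
          have h2 : u.ts < j := hij
          omega
        · exact le_rfl
      -- Any other tuple below `i` lies below the predecessor of `i`, which is in `C`; its successor
      -- is therefore already smaller than `i`.
      · have key : u.ts < i → u.ts < (findLts i L).ts := fun hlt =>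
          lt_of_le_of_ne (hp.2.2 _ hCu hlt) hts
        refine ⟨fun k hk => ?_, fun ho j hj hij => ?_⟩
        · obtain ⟨h1, h2, h3⟩ := hs.1 k hk
          refine ⟨Or.inl h1, h2, fun j hj hij => ?_⟩
          rcases hj with hj | rfl
          · exact h3 j hj hij
          · exact (h3 _ hp.1 (key hij)).trans hp.2.1.le
        · rcases hj with hj | rfl
          · exact hs.2 ho j hj hij
          · exact hs.2 ho _ hp.1 (key hij)
  active l hl := by
    obtain ⟨hA, hli⟩ := hl
    obtain ⟨u, hu, hp⟩ := h.active l hA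
    -- The predecessor of `l` changes exactly when `i` falls between it and `l`.
    by_cases hil : i < l ∧ u.ts < i
    · refine ⟨_, mem_insVersion.2 (Or.inl rfl), Or.inr rfl, hil.1, fun j hj hjl => ?_⟩
      rcases hj with hj | rfl
      · exact (hp.2.2 j hj hjl).trans hil.2.le
      · exact le_rfl
    · refine ⟨_, mem_insVersion.2 (Or.inr ⟨u, hu, rfl⟩), ?_⟩
      have : (if u.ts = (findLts i L).ts then { u with nts := some i } else u).ts = u.ts := by
        split_ifs <;> rfl
      rw [this]
      refine ⟨Or.inl hp.1, hp.2.1, fun j hj hjl => ?_⟩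
      rcases hj with hj | rfl
      · exact hp.2.2 j hj hjl
      · exact not_lt.1 fun hlt => hil ⟨hjl, hlt⟩

theorem ListInv.insTuple [Zero V] {C A : ℕ → Prop} {L : List (VTuple V)}
    (h : ListInv C A L) {i : ℕ} (v : V) (th : ℕ) {live : Finset ℕ} (hi : A i) (hC : ¬ C i)
    (hA : ∀ l, A l → ¬ C l ∧ (l ∈ live ∨ i ≤ l ∧ ∀ k, C k → k ≤ l)) :
    ListInv (fun k => C k ∨ k = i) (fun k => A k ∧ k ≠ i) (insTuple th live i v L) := by
  have h' := h.insVersion v hi hC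
  refine ⟨fun t ht => h'.writer t (mem_of_mem_insTuple ht),
    fun t ht => h'.succ t (mem_of_mem_insTuple ht), fun l hl => ?_⟩
  obtain ⟨t, ht, hp⟩ := h'.active l hl
  refine ⟨t, mem_insTuple_of_live ht fun m hm => ?_, hp⟩
  have hs := h'.succ t ht
  rw [hm] at hs
  have hle := hs.le_of_pred hp
  have hne : m ≠ l := by
    rintro rfl
    rcases (hs.1 m rfl).1 with hc | hc
    · exact (hA m hl.1).1 hc
    · exact hl.2 hc
  rcases (hA l hl.1).2 with hlive | ⟨hil, hmax⟩
  · exact ⟨l, hlive, hp.2.1, lt_of_le_of_ne hle hne.symm⟩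
  -- An unstarted `l` dominates `C` and `i`, so its predecessor cannot have a successor `m ≥ l`
  -- other than `l` itself.
  · exfalso
    rcases (hs.1 m rfl).1 with hc | hc
    · exact hne (le_antisymm (hmax m hc) hle)
    · exact hne (le_antisymm (hc ▸ hil) hle)

theorem writeVal_eq_some {ws : List (Fin n × V)} {x : Fin n} {v : V}
    (h : writeVal ws x = some v) : (x, v) ∈ ws := by
  unfold writeVal at h
  obtain ⟨d, hd, rfl⟩ := Option.map_eq_some_iff.1 h
  have h1 := List.find?_some hd
  have h2 := List.mem_of_find?_eq_some hd
  obtain rfl : d.1 = x := by simpa using h1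
  simpa using h2

theorem writeVal_eq_none {ws : List (Fin n × V)} {x : Fin n}
    (h : writeVal ws x = none) (v : V) : (x, v) ∉ ws := by
  intro hm
  simp only [writeVal, Option.map_eq_none_iff, List.find?_eq_none, List.mem_reverse] at h
  simpa using h _ hm

end MVTO

/-! ## The invariant of the executions -/

/-- The order of events: a transaction starts after all smaller ones, and commits only with its
last event. -/
def EventOrder {n : ℕ} {V : Type*} (e f : Event n V) : Prop :=
  (∀ k, f = Event.start k → e.tx < k) ∧ (e.tx = f.tx → ∀ k, e ≠ Event.commit k)

namespace MVTO

variable {n : ℕ} {V : Type*}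

/-- The part of the invariant of the executions that concerns the order of the events. -/
structure BaseInv (H : History n V) (s : MVState n V) : Prop where
  tx_lt : ∀ e ∈ H, e.tx < s.tcntr
  live_iff : ∀ k, k ∈ s.liveL ↔ H.Live k
  start_mem : ∀ e ∈ H, Event.start e.tx ∈ H
  order : H.Pairwise EventOrder
  init_committed : H.Committed 0
  -- `T_0` is excluded: its writes are in the initial history, but its write list is empty.
  ws_iff : ∀ k, k ≠ 0 → ∀ x v, (x, v) ∈ s.ws k ↔ Event.write k x v ∈ H

/-- The transactions that are live or not yet started. -/
def Active (s : MVState n V) (l : ℕ) : Prop := l ∈ s.liveL ∨ s.tcntr ≤ l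

/-- The invariant of the executions. -/
structure Inv (H : History n V) (s : MVState n V) : Prop extends BaseInv H s where
  list : ∀ x, ListInv (H.CommittedWriter x) (Active s) (s.vl x)
  val : ∀ x, ∀ t ∈ s.vl x, Event.write t.ts x t.val ∈ H
  -- The read list is constrained only as long as the version read is stored; the reader may be
  -- complete and the version deleted.
  reads : ∀ (p k : ℕ) (x : Fin n) (v : V), H[p]? = some (Event.read k x v) →
    ∃ q j : ℕ, q < p ∧ H[q]? = some (Event.commit j) ∧ Event.write j x v ∈ H ∧
      IsPredIn (H.CommittedWriter x) k j ∧ ∀ t ∈ s.vl x, t.ts = j → k ∈ t.rl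

/-! ### Preservation of the invariant by each operation -/

theorem Step.start_or_live [Zero V] {s s' : MVState n V} {e : Event n V} (h : Step s e s') :
    e = Event.start s.tcntr ∨ (e.tx ∈ s.liveL ∧ ∀ k, e ≠ Event.start k) := by
  cases h <;> simp_all [Event.tx]

theorem BaseInv.not_active_committed {H : History n V} {s : MVState n V} (h : BaseInv H s)
    {l : ℕ} (hl : Active s l) : ¬ H.Committed l := by
  intro hc
  rcases hl with hl | hl
  · exact ((h.live_iff l).1 hl).2.1 hc
  · exact absurd (h.tx_lt _ hc) (not_lt.2 hl)

theorem Step.active_tx [Zero V] {s s' : MVState n V} {e : Event n V}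
    (hs : Step s e s') : Active s e.tx := by
  rcases hs.start_or_live with rfl | ⟨h1, -⟩
  · exact Or.inr le_rfl
  · exact Or.inl h1

theorem BaseInv.step [Zero V] {H : History n V} {s s' : MVState n V} {e : Event n V}
    (h : BaseInv H s) (hs : Step s e s') : BaseInv (H ++ [e]) s' where
  tx_lt f hf := by
    have hmono : s.tcntr ≤ s'.tcntr := by cases hs <;> simp
    rcases List.mem_append.1 hf with hf | hf
    · exact (h.tx_lt f hf).trans_le hmono
    · obtain rfl := List.mem_singleton.1 hf
      rcases hs.start_or_live with he | ⟨h1, -⟩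
      · cases hs <;> simp_all [Event.tx]
      · obtain ⟨g, hg, hge⟩ := ((h.live_iff _).1 h1).1
        exact hge ▸ (h.tx_lt g hg).trans_le hmono
  live_iff k := by
    have hk := h.live_iff k
    have hnew : ∀ g ∈ H, g.tx ≠ s.tcntr := fun g hg => (h.tx_lt g hg).ne
    have hcom : ∀ j, Event.commit j ∈ H → j ≠ s.tcntr := fun j hj => hnew _ hj
    simp only [History.Live, History.HasTx, History.Committed, History.Aborted,
      List.mem_append, List.mem_singleton] at hk ⊢
    have hor : ∀ (f : Event n V) (P : Event n V → Prop),
        (∃ g, (g ∈ H ∨ g = f) ∧ P g) ↔ (∃ g ∈ H, P g) ∨ P f := by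
      intro f P
      constructor
      · rintro ⟨g, hg | rfl, hP⟩
        · exact Or.inl ⟨g, hg, hP⟩
        · exact Or.inr hP
      · rintro (⟨g, hg, hP⟩ | hP)
        · exact ⟨g, Or.inl hg, hP⟩
        · exact ⟨f, Or.inr rfl, hP⟩
    rw [hor, hor]
    cases hs with
    | start =>
      simp only [Finset.mem_insert, hk, Event.tx, Event.IsAbort]
      constructor
      · rintro (rfl | hl)
        · refine ⟨Or.inr rfl, fun hc => ?_, fun hc => ?_⟩
          · rcases hc with hc | hc
            · exact hcom _ hc rfl
            · cases hc
          · rcases hc with ⟨g, hg, hge, -⟩ | hc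
            · exact hnew g hg hge
            · exact hc.2
        · refine ⟨Or.inl hl.1, fun hc => ?_, fun hc => ?_⟩
          · rcases hc with hc | hc
            · exact hl.2.1 hc
            · cases hc
          · rcases hc with hc | hc
            · exact hl.2.2 hc
            · exact hc.2
      · rintro ⟨h1 | h1, h2, h3⟩
        · exact Or.inr ⟨h1, fun hc => h2 (Or.inl hc), fun hc => h3 (Or.inl hc)⟩
        · exact Or.inl h1.symm
    | read i x hi =>
      have hi' := (h.live_iff i).1 hi
      by_cases hik : i = k
      · subst hik
        simp_all [Event.tx, Event.IsAbort, History.Live]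
      · simp [hk, Event.tx, Event.IsAbort, hik]
    | write i x v hi =>
      have hi' := (h.live_iff i).1 hi
      by_cases hik : i = k
      · subst hik
        simp_all [Event.tx, Event.IsAbort, History.Live]
      · simp [hk, Event.tx, Event.IsAbort, hik]
    | commitReadOnly i hi hw =>
      by_cases hik : i = k
      · simp [hik]
      · simp [hk, Event.tx, Event.IsAbort, hik, Ne.symm hik]
    | commitUpdate i th hi hw hc =>
      by_cases hik : i = k
      · simp [hik]
      · simp [hk, Event.tx, Event.IsAbort, hik, Ne.symm hik]
    | commitAbort i hi hc =>
      by_cases hik : i = k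
      · simp [hik, Event.tx, Event.IsAbort]
      · simp [hk, Event.tx, Event.IsAbort, hik, Ne.symm hik]
    | tryA i hi =>
      by_cases hik : i = k
      · simp [hik, Event.tx, Event.IsAbort]
      · simp [hk, Event.tx, Event.IsAbort, hik, Ne.symm hik]
  start_mem f hf := by
    rcases List.mem_append.1 hf with hf | hf
    · exact List.mem_append_left _ (h.start_mem f hf)
    · obtain rfl := List.mem_singleton.1 hf
      rcases hs.start_or_live with rfl | ⟨h1, -⟩
      · simp [Event.tx]
      · obtain ⟨g, hg, hge⟩ := ((h.live_iff _).1 h1).1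
        exact List.mem_append_left _ (hge ▸ h.start_mem g hg)
  order := by
    refine List.pairwise_append.2 ⟨h.order, List.pairwise_singleton _ _, fun g hg f hf => ?_⟩
    obtain rfl := List.mem_singleton.1 hf
    refine ⟨fun k hk => ?_, fun htx k hk => ?_⟩
    · rcases hs.start_or_live with he | ⟨-, h1⟩
      · rw [hk] at he
        cases he
        exact h.tx_lt g hg
      · exact absurd hk (h1 k)
    · subst hk
      exact h.not_active_committed hs.active_tx (htx ▸ hg)
  init_committed := List.mem_append_left _ h.init_committed
  ws_iff k hk0 x v := by
    have hk := h.ws_iff k hk0 x v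
    cases hs with
    | write i y w hi =>
      by_cases hik : k = i
      · subst hik
        simp [hk]
      · simp [hk, hik]
    | _ => simp [hk]

/-- A write event adds no committed writer, as its transaction is not committed yet; only a commit
can. -/
theorem committedWriter_append {H : History n V} {e : Event n V} (he : ¬ H.Committed e.tx)
    (x : Fin n) (k : ℕ) :
    (H ++ [e]).CommittedWriter x k ↔
      H.CommittedWriter x k ∨ (e = Event.commit k ∧ H.Writes k x) := by
  simp only [History.CommittedWriter, History.Committed, History.Writes, List.mem_append,
    List.mem_singleton] at he ⊢
  constructor
  · rintro ⟨h1 | h1, v, h2 | h2⟩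
    · exact Or.inl ⟨h1, v, h2⟩
    · subst h2
      exact absurd h1 he
    · exact Or.inr ⟨h1.symm, v, h2⟩
    · rw [← h1] at h2
      cases h2
  · rintro (⟨h1, v, h2⟩ | ⟨h1, v, h2⟩)
    · exact ⟨Or.inl h1, v, Or.inl h2⟩
    · exact ⟨Or.inr h1.symm, v, Or.inl h2⟩

/-- Counting unstarted transactions as active makes the active set shrink only: a start merely moves
the counter value from unstarted to live. -/
theorem Step.active_of_active [Zero V] {s s' : MVState n V} {e : Event n V}
    (hs : Step s e s') {l : ℕ} (hl : Active s' l) : Active s l := by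
  cases hs <;> simp only [Active, Finset.mem_insert, Finset.mem_erase] at hl ⊢ <;> grind

/-- The invariant is kept by the steps that commit no writer and leave the version lists
alone. -/
theorem Inv.step_of_noWriter [Zero V] {H : History n V} {s s' : MVState n V} {e : Event n V}
    (h : Inv H s) (hs : Step s e s') (hw : ∀ k x, e = Event.commit k → ¬ H.Writes k x)
    (hvl : s'.vl = s.vl) (hr : ∀ k x v, e ≠ Event.read k x v) : Inv (H ++ [e]) s' := by
  have hC : ∀ x k, (H ++ [e]).CommittedWriter x k ↔ H.CommittedWriter x k := by
    intro x k
    rw [committedWriter_append (h.not_active_committed hs.active_tx)]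
    exact or_iff_left fun hc => hw k x hc.1 hc.2
  refine ⟨h.toBaseInv.step hs, fun x => ?_, fun x t ht => ?_, fun p k x v hp => ?_⟩
  · rw [hvl]
    exact (h.list x).congr (hC x) fun l hl => hs.active_of_active hl
  · rw [hvl] at ht
    exact List.mem_append_left _ (h.val x t ht)
  · rcases lt_or_ge p H.length with hlt | hge
    · rw [List.getElem?_append_left hlt] at hp
      obtain ⟨q, j, h1, h2, h3, h4, h5⟩ := h.reads p k x v hp
      refine ⟨q, j, h1, ?_, List.mem_append_left _ h3, ?_, hvl ▸ h5⟩
      · rw [List.getElem?_append_left (h1.trans hlt), h2]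
      · rwa [funext fun k => propext (hC x k)]
    · rw [List.getElem?_append_right hge, List.getElem?_singleton] at hp
      split_ifs at hp
      exact absurd (Option.some.inj hp) (hr k x v)

theorem Inv.step_read [Zero V] {H : History n V} {s : MVState n V}
    (h : Inv H s) {i : ℕ} {x : Fin n} (hi : i ∈ s.liveL) :
    Inv (H ++ [Event.read i x (findLts i (s.vl x)).val])
      { s with vl := Function.update s.vl x (readUpdate i (s.vl x)) } := by
  have hs := Step.read s i x hi
  have hC : ∀ y, (H ++ [Event.read i x (findLts i (s.vl x)).val]).CommittedWriter y =
      H.CommittedWriter y := by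
    intro y
    funext k
    rw [committedWriter_append (h.not_active_committed hs.active_tx)]
    simp
  obtain ⟨hf, hp⟩ := (h.list x).findLts_mem (Or.inl hi)
  refine ⟨h.toBaseInv.step hs, fun y => ?_, fun y t ht => ?_, fun p k y v hpk => ?_⟩
  · rw [hC]
    by_cases hy : y = x
    · subst hy
      simp only [Function.update_self]
      exact ((h.list y).readUpdate i).congr (fun _ => Iff.rfl) fun _ hl => hl
    · simp only [Function.update_of_ne hy]
      exact (h.list y).congr (fun _ => Iff.rfl) fun _ hl => hl
  · refine List.mem_append_left _ ?_
    by_cases hy : y = x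
    · subst hy
      obtain ⟨u, hu, h1, h2, -⟩ := mem_readUpdate (by simpa using ht)
      rw [h1, h2]
      exact h.val y u hu
    · exact h.val y t (by simpa [Function.update_of_ne hy] using ht)
  · rw [hC]
    rcases lt_or_ge p H.length with hlt | hge
    · rw [List.getElem?_append_left hlt] at hpk
      obtain ⟨q, j, h1, h2, h3, h4, h5⟩ := h.reads p k y v hpk
      refine ⟨q, j, h1, ?_, List.mem_append_left _ h3, h4, fun t ht htj => ?_⟩
      · rw [List.getElem?_append_left (h1.trans hlt), h2]
      · by_cases hy : y = x
        · subst hy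
          obtain ⟨u, hu, g1, -, -, g2, -⟩ := mem_readUpdate (by simpa using ht)
          exact g2 k (h5 u hu (g1 ▸ htj))
        · exact h5 t (by simpa [Function.update_of_ne hy] using ht) htj
    · rw [List.getElem?_append_right hge, List.getElem?_singleton] at hpk
      split_ifs at hpk
      cases hpk
      -- The writer found is already committed in `H`, so its commit lies before the new read, which
      -- is the last event.
      obtain ⟨q, hq⟩ := List.mem_iff_getElem?.1 hp.1.1
      have hql : q < H.length := (List.getElem?_eq_some_iff.1 hq).1
      refine ⟨q, _, hql.trans_le hge, ?_, List.mem_append_left _ (h.val x _ hf), hp,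
        fun t ht htj => ?_⟩
      · rw [List.getElem?_append_left hql, hq]
      · obtain ⟨u, hu, g1, -, -, -, g2⟩ := mem_readUpdate (by simpa using ht)
        exact g2 htj

/-- Garbage collection uses the live set that still contains `i`; only afterwards does `i` cease to
be active. -/
theorem Inv.step_commitUpdate [Zero V] {H : History n V} {s : MVState n V}
    (h : Inv H s) {i : ℕ} (th : Fin n → ℕ) (hi : i ∈ s.liveL) (hw : s.ws i ≠ [])
    (hc : ∀ d ∈ s.ws i, CheckVersion i (s.vl d.1)) :
    Inv (H ++ [Event.commit i])
      { s with
        vl := install th s.liveL i (s.ws i) s.vl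
        liveL := s.liveL.erase i } := by
  have hs := Step.commitUpdate s i th hi hw hc
  have hci : ¬ H.Committed i := h.not_active_committed (Or.inl hi)
  have hi0 : i ≠ 0 := by
    rintro rfl
    exact hci h.init_committed
  have hlt_i : i < s.tcntr := by
    obtain ⟨g, hg, hge⟩ := ((h.live_iff _).1 hi).1
    exact hge ▸ h.tx_lt g hg
  have hA : ∀ l, Active { s with
        vl := install th s.liveL i (s.ws i) s.vl
        liveL := s.liveL.erase i } l → Active s l ∧ l ≠ i := by
    intro l hl
    refine ⟨hs.active_of_active hl, ?_⟩
    rintro rfl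
    rcases hl with hl | hl
    · simp at hl
    · exact absurd hlt_i (not_lt.2 hl)
  -- Objects separate: either `x` is not written and nothing changes, or one version is inserted and
  -- `i` joins the writers of `x`.
  have key : ∀ x, (writeVal (s.ws i) x = none ∧ install th s.liveL i (s.ws i) s.vl x = s.vl x ∧
        (H ++ [Event.commit i]).CommittedWriter x = H.CommittedWriter x) ∨
      ∃ v, (x, v) ∈ s.ws i ∧
        install th s.liveL i (s.ws i) s.vl x = insTuple (th x) s.liveL i v (s.vl x) ∧
        (H ++ [Event.commit i]).CommittedWriter x = fun k => H.CommittedWriter x k ∨ k = i := by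
    intro x
    cases hv : writeVal (s.ws i) x with
    | none =>
      refine Or.inl ⟨rfl, by simp [install, hv], ?_⟩
      funext k
      rw [committedWriter_append hci]
      refine propext (or_iff_left ?_)
      rintro ⟨he, v, hm⟩
      cases he
      exact writeVal_eq_none hv v ((h.ws_iff i hi0 x v).2 hm)
    | some v =>
      have hm := writeVal_eq_some hv
      refine Or.inr ⟨v, hm, by simp [install, hv], ?_⟩
      funext k
      rw [committedWriter_append hci]
      refine propext (or_congr_right ⟨?_, ?_⟩)
      · rintro ⟨he, -⟩
        cases he
        rfl
      · rintro rfl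
        exact ⟨rfl, v, (h.ws_iff k hi0 x v).1 hm⟩
  refine ⟨h.toBaseInv.step hs, fun x => ?_, fun x t ht => ?_, fun p k x v hpk => ?_⟩
  · rcases key x with ⟨-, h1, h2⟩ | ⟨v, -, h1, h2⟩
    · simp only [h1, h2]
      exact (h.list x).congr (fun _ => Iff.rfl) fun l hl => (hA l hl).1
    · simp only [h1, h2]
      refine ((h.list x).insTuple v (th x) (Or.inl hi) (fun hcw => hci hcw.1)
        fun l hl => ⟨fun hcw => h.not_active_committed hl hcw.1, ?_⟩).congr
        (fun _ => Iff.rfl) hA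
      exact hl.imp_right fun hl =>
        ⟨hlt_i.le.trans hl, fun k hk => (h.tx_lt _ hk.1).le.trans hl⟩
  · refine List.mem_append_left _ ?_
    dsimp only at ht
    rcases key x with ⟨-, h1, -⟩ | ⟨v, hv, h1, -⟩
    · exact h.val x t (h1 ▸ ht)
    · rcases mem_insVersion_fields (mem_of_mem_insTuple (h1 ▸ ht)) with
        ⟨g1, g2⟩ | ⟨u, hu, g1, g2, -⟩
      · rw [g1, g2]
        exact (h.ws_iff i hi0 x v).1 hv
      · rw [g1, g2]
        exact h.val x u hu
  · rcases lt_or_ge p H.length with hlt | hge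
    · rw [List.getElem?_append_left hlt] at hpk
      obtain ⟨q, j, h1, h2, h3, h4, h5⟩ := h.reads p k x v hpk
      refine ⟨q, j, h1, ?_, List.mem_append_left _ h3, ?_, ?_⟩
      · rw [List.getElem?_append_left (h1.trans hlt), h2]
      · rcases key x with ⟨-, -, g⟩ | ⟨w, hmw, -, g⟩
        · rwa [g]
        · rw [g]
          refine ⟨Or.inl h4.1, h4.2.1, fun m hm hmk => ?_⟩
          rcases hm with hm | rfl
          · exact h4.2.2 m hm hmk
          · by_contra hlt
            -- The committing transaction is assumed to lie strictly between `j` and `k`. Being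
            -- live, it has its predecessor in the list; that is `j`, with `k` among its readers,
            -- against the version check.
            obtain ⟨t, ht, hpt⟩ := (h.list x).active m (Or.inl hi)
            have htj : t.ts = j := le_antisymm
              (h4.2.2 _ hpt.1 (hpt.2.1.trans hmk)) (hpt.2.2 j h4.1 (not_le.1 hlt))
            exact hc _ hmw t ht k (h5 t ht htj) ⟨hpt.2.1, hmk⟩
      · intro t ht htj
        dsimp only at ht
        rcases key x with ⟨-, g, -⟩ | ⟨w, -, g, -⟩
        · exact h5 t (g ▸ ht) htj
        · rcases mem_insVersion_fields (mem_of_mem_insTuple (g ▸ ht)) with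
            ⟨g1, -⟩ | ⟨u, hu, g1, -, g2⟩
          -- The new version is not that of `j`, which had committed earlier.
          · exact absurd (show H.Committed i by rw [← g1, htj]; exact h4.1.1) hci
          · rw [g2]
            exact h5 u hu (g1 ▸ htj)
    · rw [List.getElem?_append_right hge, List.getElem?_singleton] at hpk
      split_ifs at hpk
      cases hpk

theorem Inv.step [Zero V] {H : History n V} {s s' : MVState n V} {e : Event n V}
    (h : Inv H s) (hs : Step s e s') : Inv (H ++ [e]) s' := by
  cases hs with
  | start => exact h.step_of_noWriter (.start s) (by simp) rfl (by simp)
  | read i x hi => exact h.step_read hi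
  | write i x v hi => exact h.step_of_noWriter (.write s i x v hi) (by simp) rfl (by simp)
  | commitReadOnly i hi hw =>
    refine h.step_of_noWriter (.commitReadOnly s i hi hw) ?_ rfl (by simp)
    rintro k x he ⟨v, hv⟩
    cases he
    have hi0 : i ≠ 0 := by
      rintro rfl
      exact h.not_active_committed (Or.inl hi) h.init_committed
    have := (h.ws_iff i hi0 x v).2 hv
    simp [hw] at this
  | commitUpdate i th hi hw hc => exact h.step_commitUpdate th hi hw hc
  | commitAbort i hi hc => exact h.step_of_noWriter (.commitAbort s i hi hc) (by simp) rfl (by simp)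
  | tryA i hi => exact h.step_of_noWriter (.tryA s i hi) (by simp) rfl (by simp)

/-! ### The initial state -/

theorem mem_initHistory [Zero V] {e : Event n V} :
    e ∈ (initHistory : History n V) ↔
      e = Event.start 0 ∨ (∃ x, e = Event.write 0 x 0) ∨ e = Event.commit 0 := by
  simp [initHistory, eq_comm]

theorem initHistory_committedWriter [Zero V] (x : Fin n) (k : ℕ) :
    (initHistory : History n V).CommittedWriter x k ↔ k = 0 := by
  simp only [History.CommittedWriter, History.Committed, History.Writes, mem_initHistory]
  constructor
  · rintro ⟨h, -⟩
    simpa using h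
  · rintro rfl
    simp

theorem Inv.init [Zero V] : Inv (initHistory : History n V) initState := by
  have htx : ∀ e ∈ (initHistory : History n V), e.tx = 0 := by
    intro e he
    rcases mem_initHistory.1 he with rfl | ⟨x, rfl⟩ | rfl <;> rfl
  have hcom : Event.commit 0 ∈ (initHistory : History n V) := mem_initHistory.2 (by simp)
  refine ⟨⟨fun e he => ?_, fun k => ?_, fun e he => ?_, ?_, hcom, fun k hk x v => ?_⟩,
    fun x => ?_, fun x t ht => ?_, fun p k x v hp => ?_⟩
  · rw [htx e he]
    exact Nat.zero_lt_one
  · refine iff_of_false (by simp [initState]) ?_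
    rintro ⟨⟨e, he, rfl⟩, h, -⟩
    rw [htx e he] at h
    exact h hcom
  · rw [htx e he]
    simp [initHistory]
  · simp only [initHistory, EventOrder, List.pairwise_cons, List.pairwise_append,
      List.pairwise_map]
    refine ⟨?_, List.pairwise_iff_forall_sublist.2 ?_, ?_, ?_⟩ <;>
      simp +contextual [Event.tx, or_imp]
  · refine iff_of_false (by simp [initState]) fun h => hk ?_
    exact htx _ h
  · rw [funext fun k => propext (initHistory_committedWriter (V := V) x k)]
    refine ⟨by simp [initState], by simp [initState, IsSuccIn], fun l hl => ?_⟩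
    refine ⟨⟨0, 0, [], none⟩, by simp [initState], rfl, ?_, fun i hi _ => hi.le⟩
    rcases hl with hl | hl
    · simp [initState] at hl
    -- The counter starts at 1, and `1 ≤ l` is `0 < l` by definition.
    · exact hl
  · obtain rfl : t = ⟨0, 0, [], none⟩ := by simpa [initState] using ht
    exact mem_initHistory.2 (by simp)
  · have := mem_initHistory.1 (List.mem_of_getElem? hp)
    simp at this

theorem Run.inv [Zero V] {H : History n V} {s : MVState n V} (h : Run H s) : Inv H s := by
  induction h with
  | init => exact Inv.init
  | step _ hs ih => exact ih.step hs

end MVTO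

/-! ## The completion of a history and the serialization by timestamps -/

namespace History

variable {n : ℕ} {V : Type*}

theorem mem_completeFrom {H R : History n V} {f : Event n V} :
    f ∈ completeFrom H R ↔ f ∈ R ∨ ∃ k, f = Event.tryA k ∧ H.Live k ∧ HasTx R k := by
  induction R with
  | nil => simp [completeFrom, HasTx]
  | cons e R ih =>
    have hcons : ∀ k, HasTx (e :: R) k ↔ e.tx = k ∨ HasTx R k := by
      intro k
      simp [HasTx]
    rw [completeFrom]
    split_ifs with h
    · simp only [List.mem_cons, ih, hcons]
      constructor
      · rintro (h1 | h1 | h1 | ⟨k, h1, h2, h3⟩)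
        · exact Or.inl (Or.inl h1)
        · exact Or.inr ⟨_, h1, h.1, Or.inl rfl⟩
        · exact Or.inl (Or.inr h1)
        · exact Or.inr ⟨k, h1, h2, Or.inr h3⟩
      · rintro ((h1 | h1) | ⟨k, h1, h2, h3 | h3⟩)
        · exact Or.inl h1
        · exact Or.inr (Or.inr (Or.inl h1))
        · exact Or.inr (Or.inl (h3 ▸ h1))
        · exact Or.inr (Or.inr (Or.inr ⟨k, h1, h2, h3⟩))
    · simp only [List.mem_cons, ih, hcons]
      constructor
      · rintro (h1 | h1 | ⟨k, h1, h2, h3⟩)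
        · exact Or.inl (Or.inl h1)
        · exact Or.inl (Or.inr h1)
        · exact Or.inr ⟨k, h1, h2, Or.inr h3⟩
      · rintro ((h1 | h1) | ⟨k, h1, h2, h3 | h3⟩)
        · exact Or.inl h1
        · exact Or.inr (Or.inl h1)
        · subst h3
          -- As nothing is inserted here, `e` is not the last event of its live transaction; the
          -- abort comes later.
          have : HasTx R e.tx := by
            by_contra hn
            exact h ⟨h2, hn⟩
          exact Or.inr (Or.inr ⟨_, h1, h2, this⟩)
        · exact Or.inr (Or.inr ⟨k, h1, h2, h3⟩)

theorem mem_completion {H : History n V} {f : Event n V} :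
    f ∈ H.completion ↔ f ∈ H ∨ ∃ k, f = Event.tryA k ∧ H.Live k := by
  rw [completion, mem_completeFrom]
  exact or_congr_right (exists_congr fun k => and_congr_right fun _ =>
    ⟨fun h => h.1, fun h => ⟨h, h.1⟩⟩)

/-- The event is not followed by an event of the same transaction if it is a commit. -/
def CommitLast (e f : Event n V) : Prop := e.tx = f.tx → ∀ k, e ≠ Event.commit k

/-- Aborts are inserted only for live transactions, which have no commit. Liveness refers to `H`
while the recursion runs through suffixes, hence `hR`. -/
theorem pairwise_completeFrom {H R : History n V} (hR : ∀ e ∈ R, e ∈ H)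
    (h : R.Pairwise CommitLast) : (completeFrom H R).Pairwise CommitLast := by
  induction R with
  | nil => simp [completeFrom]
  | cons e R ih =>
    obtain ⟨h1, h2⟩ := List.pairwise_cons.1 h
    have ih' := ih (fun f hf => hR f (List.mem_cons_of_mem _ hf)) h2
    have he : ∀ f ∈ completeFrom H R, CommitLast e f := by
      intro f hf
      rcases mem_completeFrom.1 hf with hf | ⟨k, rfl, hl, -⟩
      · exact h1 f hf
      · rintro htx m rfl
        obtain rfl : m = k := htx
        exact hl.2.1 (hR _ List.mem_cons_self)
    rw [completeFrom]
    split_ifs with hc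
    · refine List.pairwise_cons.2 ⟨fun f hf => ?_, List.pairwise_cons.2 ⟨fun f _ => ?_, ih'⟩⟩
      · rcases List.mem_cons.1 hf with rfl | hf
        · rintro - m rfl
          exact hc.1.2.1 (hR _ List.mem_cons_self)
        · exact he f hf
      · rintro - m hm
        cases hm
    · exact List.pairwise_cons.2 ⟨he, ih'⟩

/-- The transactions of `H` with identifiers below `N` one after the other. -/
def serialize (H : History n V) (N : ℕ) : History n V := (List.range N).flatMap H.proj

theorem mem_serialize {H : History n V} {N : ℕ} (hN : ∀ e ∈ H, e.tx < N) {f : Event n V} :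
    f ∈ H.serialize N ↔ f ∈ H := by
  simp only [serialize, proj, List.mem_flatMap, List.mem_range, List.mem_filter]
  constructor
  · rintro ⟨_, _, h, _⟩
    exact h
  · exact fun h => ⟨f.tx, hN f h, h, by simp⟩

theorem proj_serialize (H : History n V) (N k : ℕ) :
    (H.serialize N).proj k = if k < N then H.proj k else [] := by
  have hpp : ∀ m, (H.proj m).proj k = if m = k then H.proj k else [] := by
    intro m
    split_ifs with hm
    · subst hm
      simp [proj]
    · simp only [proj, List.filter_filter, List.filter_eq_nil_iff]
      intro e _
      simp only [Bool.and_eq_true, decide_eq_true_eq, not_and]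
      rintro h1 h2
      exact hm (h2.symm.trans h1)
  induction N with
  | zero => simp [serialize, proj]
  | succ N ih =>
    have happ : H.serialize (N + 1) = H.serialize N ++ H.proj N := by
      simp [serialize, List.range_succ]
    have : ∀ A B : History n V, proj (A ++ B) k = A.proj k ++ B.proj k := fun A B =>
      List.filter_append ..
    rw [happ, this, ih, hpp]
    split_ifs <;> first | omega | simp

/-- Each block keeps the order of `H`, and events of different blocks belong to different
transactions. -/
theorem pairwise_serialize {H : History n V} (h : H.Pairwise CommitLast) (N : ℕ) :
    (H.serialize N).Pairwise fun e f => e.tx ≤ f.tx ∧ CommitLast e f := by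
  have hmem : ∀ m, ∀ e ∈ H.proj m, e.tx = m := fun m e he => by
    simpa using (List.mem_filter.1 he).2
  rw [serialize, List.pairwise_flatMap]
  refine ⟨fun m _ => ?_, List.pairwise_lt_range.imp fun {a b} hab e he f hf => ?_⟩
  · refine (h.filter _).imp_of_mem fun {e f} he hf hef => ⟨?_, hef⟩
    rw [hmem m e he, hmem m f hf]
  · have h1 := hmem a e he
    have h2 := hmem b f hf
    exact ⟨by omega, fun htx => absurd htx (by omega)⟩

theorem rel_of_pairwise_getElem? {α : Type*} {R : α → α → Prop} {L : List α} (h : L.Pairwise R)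
    {p q : ℕ} {a b : α} (hp : L[p]? = some a) (hq : L[q]? = some b) (hpq : p < q) : R a b := by
  obtain ⟨hp', rfl⟩ := List.getElem?_eq_some_iff.1 hp
  obtain ⟨hq', rfl⟩ := List.getElem?_eq_some_iff.1 hq
  exact List.pairwise_iff_getElem.1 h p q hp' hq' hpq

end History

/-! ### Opacity and the read and write rules -/

/-- Every history generated by the algorithm is opaque: serialize by timestamps. -/
theorem MVTO.Inv.isOpaque {n : ℕ} {V : Type*} {H : History n V} {s : MVState n V}
    (h : MVTO.Inv H s) : H.IsOpaque := by
  refine ⟨fun p k x v hp => ?_, ?_⟩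
  · obtain ⟨q, j, h1, h2, h3, -⟩ := h.reads p k x v hp
    exact ⟨q, j, h1, h2, h3⟩
  have hbound : ∀ e ∈ H.completion, e.tx < s.tcntr := by
    intro e he
    rcases History.mem_completion.1 he with he | ⟨k, rfl, ⟨g, hg, rfl⟩, -⟩
    · exact h.tx_lt e he
    · exact h.tx_lt g hg
  set S := H.completion.serialize s.tcntr with hS
  have hmemS : ∀ f, f ∈ S ↔ f ∈ H ∨ ∃ k, f = Event.tryA k ∧ H.Live k := fun f =>
    (History.mem_serialize hbound).trans History.mem_completion
  have hpw : S.Pairwise fun e f => e.tx ≤ f.tx ∧ History.CommitLast e f :=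
    History.pairwise_serialize (History.pairwise_completeFrom (fun _ he => he)
      (h.order.imp fun hef => hef.2)) _
  have hhas : ∀ k, S.HasTx k ↔ H.HasTx k := by
    intro k
    constructor
    · rintro ⟨e, he, rfl⟩
      rcases (hmemS e).1 he with he | ⟨k, rfl, hl⟩
      · exact ⟨e, he, rfl⟩
      · exact hl.1
    · rintro ⟨e, he, rfl⟩
      exact ⟨e, (hmemS e).2 (Or.inl he), rfl⟩
  have hcomplete : ∀ k, H.HasTx k → S.Complete k := by
    intro k hk
    by_cases hc : H.Committed k
    · exact Or.inl ((hmemS _).2 (Or.inl hc))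
    · by_cases ha : H.Aborted k
      · obtain ⟨e, he, h1⟩ := ha
        exact Or.inr ⟨e, (hmemS e).2 (Or.inl he), h1⟩
      · exact Or.inr ⟨Event.tryA k, (hmemS _).2 (Or.inr ⟨k, rfl, hk, hc, ha⟩), rfl, trivial⟩
  have hRT : ∀ k m, H.HasTx k → H.HasTx m → k < m → S.RT k m := by
    intro k m hk hm hkm
    refine ⟨hcomplete k hk, (hhas m).2 hm, fun p q e f hp hq he hf => ?_⟩
    rcases lt_trichotomy p q with hlt | rfl | hlt
    · exact hlt
    · rw [hp] at hq
      cases hq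
      omega
    · have := (History.rel_of_pairwise_getElem? hpw hq hp hlt).1
      omega
  have hcommit : ∀ k, Event.commit k ∈ S ↔ H.Committed k := fun k =>
    (hmemS _).trans (by simp [History.Committed])
  have hwrite : ∀ k x v, Event.write k x v ∈ S ↔ Event.write k x v ∈ H := fun k x v =>
    (hmemS _).trans (by simp)
  refine ⟨S, fun k m hk hm hkm => ?_, fun p k x v hp => ?_, fun k => ?_, fun k m hkm => ?_⟩
  · rw [hhas] at hk hm
    exact hkm.lt_or_gt.imp (hRT k m hk hm) (hRT m k hm hk)
  · have hr : Event.read k x v ∈ H := by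
      simpa using (hmemS _).1 (List.mem_of_getElem? hp)
    obtain ⟨p', hp'⟩ := List.mem_iff_getElem?.1 hr
    obtain ⟨-, j, -, -, hw, hpred, -⟩ := h.reads p' k x v hp'
    obtain ⟨q, hq⟩ := List.mem_iff_getElem?.1 ((hcommit j).2 hpred.1.1)
    have hjk : q < p := (hRT j k ⟨_, hpred.1.1, rfl⟩ ⟨_, hr, rfl⟩ hpred.2.1).2.2
      q p _ _ hq hp rfl rfl
    refine ⟨q, j, hjk, hq, ⟨v, (hwrite j x v).2 hw⟩, ?_, (hwrite j x v).2 hw⟩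
    rintro q' i hqq hqp hi ⟨w, hiw⟩
    have hicw : H.CommittedWriter x i :=
      ⟨(hcommit i).1 (List.mem_of_getElem? hi), w, (hwrite i x w).1 hiw⟩
    obtain ⟨h1, h2⟩ := History.rel_of_pairwise_getElem? hpw hq hi hqq
    obtain ⟨h3, h4⟩ := History.rel_of_pairwise_getElem? hpw hi hp hqp
    -- A commit is the last event of its transaction, so both timestamp inequalities are strict and
    -- `i` would be a writer between `j` and `k`.
    have hji : j ≠ i := fun hji => h2 hji j rfl
    have hik : i ≠ k := fun hik => h4 hik i rfl
    have h1' : j ≤ i := h1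
    have h3' : i ≤ k := h3
    have := hpred.2.2 i hicw (lt_of_le_of_ne h3' hik)
    omega
  · rw [hS, History.proj_serialize]
    split_ifs with hk
    · rfl
    · refine (List.filter_eq_nil_iff.2 fun e he => ?_).symm
      have := hbound e he
      simp only [decide_eq_true_eq]
      omega
  · have hkH : H.HasTx k := by
      rcases hkm.1 with hc | ⟨e, he, htx, -⟩
      · exact ⟨_, hc, rfl⟩
      · exact ⟨e, he, htx⟩
    refine hRT k m hkH hkm.2.1 ?_
    obtain ⟨e, he, rfl⟩ := hkH
    obtain ⟨f, hf, rfl⟩ := hkm.2.1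
    -- Comparing the two start events suffices: a start has a larger timestamp than every earlier
    -- event.
    obtain ⟨p, hp⟩ := List.mem_iff_getElem?.1 (h.start_mem e he)
    obtain ⟨q, hq⟩ := List.mem_iff_getElem?.1 (h.start_mem f hf)
    have hpq := hkm.2.2 p q _ _ hp hq rfl rfl
    exact (History.rel_of_pairwise_getElem? h.order hp hq hpq).1 _ rfl

/-- The invariant gives some writer of the value read that is the predecessor of `k`; unique writes
identify it with `j`. -/
theorem MVTO.Inv.readRule {n : ℕ} {V : Type*} {H : History n V} {s : MVState n V}
    (h : MVTO.Inv H s) (hU : H.UniqueWrites) {k : ℕ} {x : Fin n} {j : ℕ}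
    (hr : H.ReadsFrom k x j) : H.IsLTS k x j := by
  obtain ⟨p, q, v, -, hp, -, hw⟩ := hr
  obtain ⟨-, j', -, -, hw', hpred, -⟩ := h.reads p k x v hp
  obtain rfl := hU j j' x v hw hw'
  exact hpred

theorem mainTheorem4 {n : ℕ} {V : Type*} [Zero V]
    (H : History n V) (hH : ∃ s : MVState n V, MVTO.Run H s) (hU : H.UniqueWrites) :
    -- after every prefix, the needed versions are present and the `nts` entries are correct
    (∀ (Hp : History n V) (sp : MVState n V), Hp <+: H → MVTO.Run Hp sp →
      (∀ (l : ℕ) (x : Fin n), Hp.Live l →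
        ∃ (j : ℕ) (vt : VTuple V), Hp.IsLTS l x j ∧ MVTO.version sp x j = some vt ∧
          Hp.IsSTL l x vt.nts) ∧
      (∀ (x : Fin n), ∀ vt ∈ sp.vl x,
        Hp.CommittedWriter x vt.ts ∧ Hp.IsSTL vt.ts x vt.nts)) ∧
    -- read rule
    (∀ (k : ℕ) (x : Fin n) (j : ℕ), H.ReadsFrom k x j → H.IsLTS k x j) ∧
    -- write rule
    (∀ (k : ℕ) (x : Fin n) (j i : ℕ), H.ReadsFrom k x j → H.CommittedWriter x i →
      i ≠ j → i ≠ k → Xor (i < j) (k < i)) ∧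
    -- opacity
    H.IsOpaque := by
  obtain ⟨s, hs⟩ := hH
  have hI := hs.inv
  refine ⟨fun Hp sp _ hrun => ?_, fun k x j hr => hI.readRule hU hr,
    fun k x j i hr hi hij hik => ?_, hI.isOpaque⟩
  · have hp := hrun.inv
    refine ⟨fun l x hl => ?_, fun x vt hvt =>
      ⟨(hp.list x).writer vt hvt, (isSTL_iff ..).2 ((hp.list x).succ vt hvt)⟩⟩
    obtain ⟨t, ht, hpred⟩ := (hp.list x).active l (Or.inl ((hp.live_iff l).2 hl))
    -- The search may return a tuple other than `t` with the same timestamp; the invariant holds for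
    -- every tuple, so this does not matter.
    cases hv : MVTO.version sp x t.ts with
    | none => simpa using List.find?_eq_none.1 hv t ht
    | some vt =>
      have hts : vt.ts = t.ts := by simpa using List.find?_some hv
      have hs' := (hp.list x).succ vt (List.mem_of_find?_eq_some hv)
      rw [hts] at hs'
      exact ⟨t.ts, vt, hpred, hv, (isSTL_iff ..).2 (hs'.of_pred hpred fun hc => hl.2.1 hc.1)⟩
  · obtain ⟨-, hjk, hmax⟩ := hI.readRule hU hr
    rcases lt_or_gt_of_ne hik with hlt | hgt
    · exact Or.inl ⟨lt_of_le_of_ne (hmax i hi hlt) hij, by omega⟩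
    · exact Or.inr ⟨hgt, by omega⟩
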